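/- Let $A$ be a normal square complex matrix (of size at least $1$), let $n\ge 1$, and let $z_1,\dots,z_n\in\mathbb C$ be arbitrary, possibly repeated, points. Let $p$ be the interpolation polynomial of $f(z)=e^z$ at $z_1,\dots,z_n$ taking multiplicities into account, i.e. the polynomial of degree less than $n$ such that $p^{(j)}(z_k)=e^{z_k}$ for all $k$ and all $0\le j<m_k$, where $m_k$ is the number of indices $i$ with $z_i=z_k$. Put $\Omega(z)=\prod_{k=1}^n(z-z_k)$ and $$\alpha=\max\{\operatorname{Re}\lambda:\lambda\in\sigma(A)\},\qquad \beta=\max_{1\le k\le n}\operatorname{Re}z_k,\qquad \gamma=\max\{\alpha,\beta\},$$ where $\sigma(A)$ is the spectrum of $A$. Then $$\lVert e^A-p(A)\rVert_{2\to2}\le e^{\gamma}\,\frac{\lVert\Omega(A)\rVert_{2\to2}}{n!},$$ where $\lVert\cdot\rVert_{2\to2}$ is the matrix norm induced by the Euclidean norm. -/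

import Mathlib

open scoped Matrix.Norms.L2Operator

/-- The polynomial `Ω(z) = ∏ k, (z - z k)` of the interpolation points (with repetitions). -/
noncomputable def nodePoly {n : ℕ} (z : Fin n → ℂ) : Polynomial ℂ :=
  ∏ k, (Polynomial.X - Polynomial.C (z k))

/-- The multiplicity of the point `z k` in the list `z`. -/
noncomputable def nodeMult {n : ℕ} (z : Fin n → ℂ) (k : Fin n) : ℕ :=
  (Finset.univ.filter fun i => z i = z k).card

/-- `p` is the interpolation polynomial of `f` at the (possibly repeated) points `z k`:
its degree is less than the number `n` of points, and at every point of multiplicity `m`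
its derivatives of orders `0, …, m - 1` are those of `f`. -/
def IsInterpolationPolynomial {n : ℕ} (f : ℂ → ℂ) (z : Fin n → ℂ) (p : Polynomial ℂ) : Prop :=
  p.degree < n ∧ ∀ k : Fin n, ∀ j < nodeMult z k,
    (Polynomial.derivative^[j] p).eval (z k) = iteratedDeriv j f (z k)

/-- `α`: the largest real part of a point of the spectrum of `A`
(a finite set, nonempty for a matrix of positive size). -/
noncomputable def spectralAbscissa {ι : Type*} [Fintype ι] [DecidableEq ι]
    (A : Matrix ι ι ℂ) : ℝ :=
  sSup (Complex.re '' spectrum ℂ A)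

/-- `β`: the largest real part of an interpolation point. -/
noncomputable def nodeAbscissa {n : ℕ} (z : Fin n → ℂ) : ℝ :=
  sSup (Set.range fun k => (z k).re)

open Polynomial Filter Topology

/-! Since `A` is normal, the norm of a function of `A` is the maximum of its modulus on the
spectrum, so it suffices to prove `|e^w - p(w)| ≤ e^γ |Ω(w)| / n!` at each spectral point `w`.
Newton's formula (`exp_eq_eval_expNewtonPoly_add`) writes the error as `Ω(w)` times a divided
difference of `exp`. That divided difference is an iterated convolution of exponentials, which makes
sense for repeated nodes; estimating it as an integral over a simplex of volume `1/n!` gives `e^γ /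
n!` (`norm_expDividedDiff_le`). Finally `p` is the Newton polynomial, because their difference has
`n` roots with multiplicity but degree less than `n`. -/

/-- The divided difference of `x ↦ exp (t * x)` at `w` and the points of the list, built up by
the variation of constants formula. -/
noncomputable def expDividedDiff : List ℂ → ℂ → ℝ → ℂ
  | [], w, t => Complex.exp (w * t)
  | v :: l, w, t => Complex.exp (w * t) * ∫ s in (0 : ℝ)..t, Complex.exp (-w * s) *
      expDividedDiff l v s

/-- The Newton form of the interpolation polynomial of `exp` at the points of the list. -/
noncomputable def expNewtonPoly : List ℂ → ℂ[X]
  | [] => 0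
  | v :: l => expNewtonPoly l + C (expDividedDiff l v 1) * (l.map fun a => X - C a).prod

/-- Continuity in `t` lets the defining integral be differentiated; continuity in the free node
controls the remainder near a node. -/
theorem continuous_uncurry_expDividedDiff (l : List ℂ) :
    Continuous fun q : ℂ × ℝ => expDividedDiff l q.1 q.2 := by
  induction l with
  | nil => simp only [expDividedDiff]; fun_prop
  | cons v l ih =>
    simp only [expDividedDiff]
    have hv : Continuous fun s : ℝ => expDividedDiff l v s :=
      ih.comp (Continuous.prodMk continuous_const continuous_id)
    refine Continuous.mul (by fun_prop) ?_
    exact intervalIntegral.continuous_parametric_intervalIntegral_of_continuous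
      (f := fun (q : ℂ × ℝ) (s : ℝ) => Complex.exp (-q.1 * s) * expDividedDiff l v s)
      (by simp only [Function.uncurry_def]; fun_prop) continuous_snd

theorem continuous_expDividedDiff_right (l : List ℂ) (w : ℂ) :
    Continuous fun t : ℝ => expDividedDiff l w t :=
  (continuous_uncurry_expDividedDiff l).comp (Continuous.prodMk continuous_const continuous_id)

theorem hasDerivAt_cexp_mul_ofReal (w : ℂ) (t : ℝ) :
    HasDerivAt (fun t : ℝ => Complex.exp (w * t)) (w * Complex.exp (w * t)) t := by
  have h : HasDerivAt (fun t : ℝ => w * (t : ℂ)) w t := by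
    simpa using (Complex.ofRealCLM.hasDerivAt (x := t)).const_mul w
  simpa [mul_comm] using h.cexp

theorem hasDerivAt_expDividedDiff_cons (v : ℂ) (l : List ℂ) (w : ℂ) (t : ℝ) :
    HasDerivAt (fun t : ℝ => expDividedDiff (v :: l) w t)
      (w * expDividedDiff (v :: l) w t + expDividedDiff l v t) t := by
  have hc : Continuous fun s : ℝ => Complex.exp (-w * s) * expDividedDiff l v s := by
    have := continuous_expDividedDiff_right l v
    fun_prop
  have h := (hasDerivAt_cexp_mul_ofReal w t).mul (hc.integral_hasStrictDerivAt 0 t).hasDerivAt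
  simp only [expDividedDiff]
  refine h.congr_deriv ?_
  rw [← mul_assoc (Complex.exp (w * t)) (Complex.exp (-w * t)), ← Complex.exp_add]
  simp [mul_assoc]

theorem expDividedDiff_cons_zero (v : ℂ) (l : List ℂ) (w : ℂ) :
    expDividedDiff (v :: l) w 0 = 0 := by
  simp [expDividedDiff]

/-- The divided differences with a free last node solve one linear equation with a source term and
an initial value that do not depend on this node. -/
theorem exists_source_expDividedDiff (l : List ℂ) :
    ∃ (a : ℂ) (c : ℝ → ℂ), ∀ w, expDividedDiff l w 0 = a ∧ ∀ t : ℝ,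
      HasDerivAt (fun t : ℝ => expDividedDiff l w t) (w * expDividedDiff l w t + c t) t := by
  cases l with
  | nil =>
    refine ⟨1, 0, fun w => ⟨by simp [expDividedDiff], fun t => ?_⟩⟩
    simpa [expDividedDiff] using hasDerivAt_cexp_mul_ofReal w t
  | cons v l =>
    exact ⟨0, fun t => expDividedDiff l v t, fun w => ⟨expDividedDiff_cons_zero v l w,
      hasDerivAt_expDividedDiff_cons v l w⟩⟩

/-- The integrating factor `exp (-w t)` makes the difference of two solutions constant. -/
theorem eq_of_hasDerivAt_linear {y₁ y₂ c : ℝ → ℂ} {w : ℂ}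
    (h₁ : ∀ t, HasDerivAt y₁ (w * y₁ t + c t) t) (h₂ : ∀ t, HasDerivAt y₂ (w * y₂ t + c t) t)
    (h₀ : y₁ 0 = y₂ 0) (t : ℝ) : y₁ t = y₂ t := by
  have h : ∀ t : ℝ, HasDerivAt (fun t : ℝ => Complex.exp (-w * t) * (y₁ t - y₂ t)) 0 t := fun t =>
    ((hasDerivAt_cexp_mul_ofReal (-w) t).mul ((h₁ t).sub (h₂ t))).congr_deriv (by
      simp only [Pi.sub_apply]; ring)
  have := is_const_of_deriv_eq_zero (fun t => (h t).differentiableAt) (fun t => (h t).deriv) t 0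
  simpa [h₀, sub_eq_zero] using this

/-- The divided difference recurrence, free of division and hence valid for `w = v`: both sides
solve `y' = w y + c` with the same initial value. -/
theorem expDividedDiff_eq_add (l : List ℂ) (v w : ℂ) (t : ℝ) :
    expDividedDiff l w t = expDividedDiff l v t + (w - v) * expDividedDiff (v :: l) w t := by
  obtain ⟨a, c, h⟩ := exists_source_expDividedDiff l
  refine eq_of_hasDerivAt_linear (w := w) (c := c) (h w).2 (fun t => ?_) ?_ t
    (y₂ := fun t => expDividedDiff l v t + (w - v) * expDividedDiff (v :: l) w t)
  · refine (((h v).2 t).add ((hasDerivAt_expDividedDiff_cons v l w t).const_mul (w - v))).congr_deriv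
      ?_
    ring
  · simp [(h w).1, (h v).1, expDividedDiff_cons_zero]

/-- Applying the recurrence to the remainder splits off exactly the next Newton term. -/
theorem exp_eq_eval_expNewtonPoly_add (l : List ℂ) (w : ℂ) :
    Complex.exp w = (expNewtonPoly l).eval w +
      ((l.map fun a => X - C a).prod).eval w * expDividedDiff l w 1 := by
  induction l with
  | nil => simp [expNewtonPoly, expDividedDiff]
  | cons v l ih =>
    rw [ih, expDividedDiff_eq_add l v w 1]
    simp [expNewtonPoly]
    ring

/-- In the convolution the factors `e^(γ(t-s))` and `e^(γs)` combine to `e^(γt)`, leaving the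
integral of `s^k / k!`. -/
theorem norm_expDividedDiff_le {γ : ℝ} (l : List ℂ) (hl : ∀ v ∈ l, v.re ≤ γ) (w : ℂ)
    (hw : w.re ≤ γ) {t : ℝ} (ht : 0 ≤ t) :
    ‖expDividedDiff l w t‖ ≤ Real.exp (γ * t) * (t ^ l.length / (l.length.factorial : ℝ)) := by
  induction l generalizing w t with
  | nil =>
    simp only [expDividedDiff, Complex.norm_exp]
    simpa using mul_le_mul_of_nonneg_right hw ht
  | cons v l ih =>
    simp only [List.mem_cons, forall_eq_or_imp] at hl
    rw [expDividedDiff, ← intervalIntegral.integral_const_mul]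
    have hint : ∫ s in (0 : ℝ)..t, Real.exp (γ * t) * (s ^ l.length / (l.length.factorial : ℝ)) =
        Real.exp (γ * t) * (t ^ (v :: l).length / ((v :: l).length.factorial : ℝ)) := by
      rw [intervalIntegral.integral_const_mul, intervalIntegral.integral_div, integral_pow]
      simp [Nat.factorial_succ, div_div]
    rw [← hint]
    refine intervalIntegral.norm_integral_le_of_norm_le ht (Eventually.of_forall fun s hs => ?_)
      (Continuous.intervalIntegrable (by fun_prop) _ _)
    rw [← mul_assoc, ← Complex.exp_add, norm_mul, Complex.norm_exp]
    have h₁ : (w * t + -w * s).re ≤ γ * (t - s) := by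
      have := mul_le_mul_of_nonneg_right hw (sub_nonneg.2 hs.2)
      simp
      linarith
    calc Real.exp (w * t + -w * s).re * ‖expDividedDiff l v s‖
        ≤ Real.exp (γ * (t - s)) *
          (Real.exp (γ * s) * (s ^ l.length / (l.length.factorial : ℝ))) := by
          gcongr
          exact ih hl.2 v hl.1 hs.1.le
      _ = Real.exp (γ * t) * (s ^ l.length / (l.length.factorial : ℝ)) := by
          rw [← mul_assoc, ← Real.exp_add]
          ring_nf

theorem degree_expNewtonPoly_lt (l : List ℂ) : (expNewtonPoly l).degree < l.length := by
  induction l with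
  | nil => simp [expNewtonPoly]
  | cons v l ih =>
    have hprod : ((l.map fun a => (X - C a : ℂ[X])).prod).degree = (l.length : WithBot ℕ) := by
      rw [degree_list_prod]
      simp [Function.comp_def]
    refine (degree_add_le _ _).trans_lt (max_lt (ih.trans ?_) ?_)
    · exact_mod_cast Nat.lt_succ_self _
    · rw [← smul_eq_C_mul]
      refine (degree_smul_le _ _).trans_lt ?_
      rw [hprod]
      exact_mod_cast Nat.lt_succ_self _

/-- A polynomial that is `(x - a) ^ m` times a function continuous at `a` has a root of
multiplicity at least `m` there. -/
theorem Polynomial.le_rootMultiplicity_of_eventually_eq {q : ℂ[X]} (hq : q ≠ 0) {a : ℂ} {m : ℕ}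
    {h : ℂ → ℂ} (hh : ContinuousAt h a) (hqh : ∀ᶠ x in 𝓝 a, q.eval x = (x - a) ^ m * h x) :
    m ≤ q.rootMultiplicity a := by
  by_contra! hlt
  obtain ⟨r, hr, hndvd⟩ := exists_eq_pow_rootMultiplicity_mul_and_not_dvd q hq a
  set k := q.rootMultiplicity a
  have hr0 : r.eval a ≠ 0 := fun h0 => hndvd (dvd_iff_isRoot.2 h0)
  -- If `k < m`, cancelling `(x - a)^k` forces the cofactor `r` to tend to `0` at `a`, although
  -- `r(a) ≠ 0`.
  have hlim : Tendsto (fun x => (x - a) ^ (m - k) * h x) (𝓝 a) (𝓝 0) := by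
    have : ContinuousAt (fun x => (x - a) ^ (m - k) * h x) a := by fun_prop
    simpa [ContinuousAt, (Nat.sub_pos_of_lt hlt).ne'] using this
  have heq : ∀ᶠ x in 𝓝[≠] a, r.eval x = (x - a) ^ (m - k) * h x := by
    filter_upwards [hqh.filter_mono nhdsWithin_le_nhds, self_mem_nhdsWithin] with x hx hxa
    have hxa' : (x - a) ^ k ≠ 0 := pow_ne_zero _ (sub_ne_zero.2 hxa)
    refine mul_left_cancel₀ hxa' ?_
    rw [← mul_assoc, ← pow_add, Nat.add_sub_cancel' hlt.le, ← hx]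
    conv_rhs => rw [hr]
    simp
  refine hr0 (tendsto_nhds_unique (r.continuous.continuousAt.tendsto.mono_left
    (nhdsWithin_le_nhds (s := {a}ᶜ))) ?_)
  exact (hlim.mono_left nhdsWithin_le_nhds).congr' (heq.mono fun _ hx => hx.symm)

theorem Polynomial.iteratedDeriv_eval (q : ℂ[X]) (j : ℕ) :
    iteratedDeriv j (fun x => q.eval x) = fun x => (derivative^[j] q).eval x := by
  induction j generalizing q with
  | zero => simp
  | succ j ih =>
    have hd : deriv (fun x => q.eval x) = fun x => (derivative q).eval x :=  by
      ext x
      exact q.deriv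
    rw [iteratedDeriv_succ', hd, ih, Function.iterate_succ_apply]

theorem nodePoly_eq_list_prod {n : ℕ} (z : Fin n → ℂ) :
    nodePoly z = ((List.ofFn z).map fun a => X - C a).prod := by
  simp [nodePoly, List.map_ofFn, List.prod_ofFn]

theorem nodeMult_eq_count {n : ℕ} (z : Fin n → ℂ) (k : Fin n) :
    nodeMult z k = (Finset.univ.val.map z).count (z k) := by
  rw [Multiset.count_map, nodeMult, Finset.card_def, Finset.filter_val]
  simp only [eq_comm]

theorem nodePoly_eq_pow_mul {n : ℕ} (z : Fin n → ℂ) (k : Fin n) :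
    ∃ g : ℂ[X], nodePoly z = (X - C (z k)) ^ nodeMult z k * g := by
  classical
  refine ⟨∏ i with ¬ z i = z k, (X - C (z i)), ?_⟩
  rw [nodePoly, ← Finset.prod_filter_mul_prod_filter_not Finset.univ (fun i => z i = z k)]
  congr 1
  rw [Finset.prod_congr rfl (g := fun _ => X - C (z k)) (by simp +contextual), Finset.prod_const,
    nodeMult]

/-- The interpolation conditions determine the polynomial. -/
theorem IsInterpolationPolynomial.eq_expNewtonPoly {n : ℕ} {z : Fin n → ℂ} {p : ℂ[X]}
    (hp : IsInterpolationPolynomial Complex.exp z p) : p = expNewtonPoly (List.ofFn z) := by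
  by_contra hne
  set q := p - expNewtonPoly (List.ofFn z) with hq
  have hq0 : q ≠ 0 := sub_ne_zero.2 hne
  -- The nodes, with repetitions, are all roots of `q`, which is too many for its degree.
  have hroots : Finset.univ.val.map z ≤ q.roots := by
    rw [Multiset.le_iff_count]
    intro a
    by_cases ha : a ∈ Finset.univ.val.map z
    swap
    · exact (Multiset.count_eq_zero_of_notMem ha).trans_le (Nat.zero_le _)
    obtain ⟨k, -, rfl⟩ := Multiset.mem_map.1 ha
    rw [count_roots, ← nodeMult_eq_count]
    have han : AnalyticAt ℂ (fun x => p.eval x - Complex.exp x) (z k) := by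
      have : AnalyticAt ℂ (fun x => p.eval x) (z k) :=
        Differentiable.analyticAt p.differentiable _
      fun_prop
    have hord : ∀ j < nodeMult z k,
        iteratedDeriv j (fun x => p.eval x - Complex.exp x) (z k) = 0 := fun j hj => by
      have hcd : ContDiff ℂ j (fun x => p.eval x) := by simpa using p.contDiff_aeval (𝕜 := ℂ) j
      rw [iteratedDeriv_fun_sub hcd.contDiffAt Complex.contDiff_exp.contDiffAt,
        Polynomial.iteratedDeriv_eval]
      exact sub_eq_zero.2 (hp.2 k j hj)
    obtain ⟨u, hu, hpu⟩ := (natCast_le_analyticOrderAt han).1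
      ((natCast_le_analyticOrderAt_iff_iteratedDeriv_eq_zero han).2 hord)
    obtain ⟨g, hg⟩ := nodePoly_eq_pow_mul z k
    have hc : Continuous fun x => expDividedDiff (List.ofFn z) x 1 :=
      (continuous_uncurry_expDividedDiff _).comp (Continuous.prodMk continuous_id continuous_const)
    -- Split `q` as `(p - exp) + (exp - Newton)`: the first vanishes to order `m` by the
    -- interpolation conditions, the second is `Ω` times a continuous function.
    refine Polynomial.le_rootMultiplicity_of_eventually_eq hq0
      (h := fun x => u x + g.eval x * expDividedDiff (List.ofFn z) x 1)
      (hu.continuousAt.add (g.continuous.mul hc).continuousAt) (hpu.mono fun x hx => ?_)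
    have hN := exp_eq_eval_expNewtonPoly_add (List.ofFn z) x
    rw [← nodePoly_eq_list_prod, hg] at hN
    simp only [eval_mul, eval_pow, eval_sub, eval_X, eval_C, smul_eq_mul] at hN hx
    rw [hq, eval_sub]
    linear_combination hx + hN
  have hcard : n ≤ q.natDegree := by
    simpa using (Multiset.card_le_card hroots).trans (card_roots' q)
  have hdeg : q.degree < n := (degree_sub_le _ _).trans_lt
    (max_lt hp.1 (by simpa using degree_expNewtonPoly_lt (List.ofFn z)))
  exact hcard.not_gt ((natDegree_lt_iff_degree_lt hq0).2 hdeg)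

/-- The error of the interpolation of `exp` at a point. -/
theorem IsInterpolationPolynomial.norm_exp_sub_eval_le {n : ℕ} {z : Fin n → ℂ} {p : ℂ[X]}
    (hp : IsInterpolationPolynomial Complex.exp z p) {γ : ℝ} (hz : ∀ k, (z k).re ≤ γ) {w : ℂ}
    (hw : w.re ≤ γ) :
    ‖Complex.exp w - p.eval w‖ ≤ Real.exp γ * (‖(nodePoly z).eval w‖ / (n.factorial : ℝ)) := by
  have h := norm_expDividedDiff_le (List.ofFn z) (by simpa [List.mem_ofFn] using hz) w hw
    zero_le_one
  simp only [mul_one, List.length_ofFn, one_pow] at h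
  rw [hp.eq_expNewtonPoly, exp_eq_eval_expNewtonPoly_add (List.ofFn z) w, add_sub_cancel_left,
    ← nodePoly_eq_list_prod, norm_mul]
  calc ‖(nodePoly z).eval w‖ * ‖expDividedDiff (List.ofFn z) w 1‖
      ≤ ‖(nodePoly z).eval w‖ * (Real.exp γ * (1 / (n.factorial : ℝ))) := by gcongr
    _ = Real.exp γ * (‖(nodePoly z).eval w‖ / (n.factorial : ℝ)) := by ring

theorem re_le_spectralAbscissa {ι : Type*} [Fintype ι] [DecidableEq ι] {A : Matrix ι ι ℂ} {w : ℂ}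
    (hw : w ∈ spectrum ℂ A) : w.re ≤ spectralAbscissa A :=
  le_csSup ((spectrum.isCompact A).image Complex.continuous_re).bddAbove ⟨w, hw, rfl⟩

theorem re_le_nodeAbscissa {n : ℕ} (z : Fin n → ℂ) (k : Fin n) : (z k).re ≤ nodeAbscissa z :=
  le_csSup (Set.finite_range _).bddAbove ⟨k, rfl⟩

/-- The norm on matrices is the operator norm induced by the Euclidean norm. -/
theorem corollary6 {ι : Type*} [Fintype ι] [DecidableEq ι] [Nonempty ι]
    (A : Matrix ι ι ℂ) (hA : IsStarNormal A)
    (n : ℕ) (hn : 1 ≤ n) (z : Fin n → ℂ)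
    (p : Polynomial ℂ) (hp : IsInterpolationPolynomial Complex.exp z p) :
    ‖NormedSpace.exp A - Polynomial.aeval A p‖ ≤
      Real.exp (max (spectralAbscissa A) (nodeAbscissa z)) *
        (‖Polynomial.aeval A (nodePoly z)‖ / (n.factorial : ℝ)) := by
  have hdiff : NormedSpace.exp A - aeval A p = cfc (fun w => Complex.exp w - p.eval w) A := by
    rw [cfc_sub Complex.exp (fun w => p.eval w) A, CFC.complex_exp_eq_normedSpace_exp,
      cfc_polynomial p A]
  rw [hdiff]
  refine norm_cfc_le (by positivity) fun w hw => ?_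
  refine (hp.norm_exp_sub_eval_le (fun k => (re_le_nodeAbscissa z k).trans (le_max_right _ _))
    ((re_le_spectralAbscissa hw).trans (le_max_left _ _))).trans ?_
  gcongr
  -- By spectral mapping, `|Ω(w)|` at a spectral point is at most the norm of `Ω(A)`.
  rw [← cfc_polynomial (nodePoly z) A]
  exact norm_apply_le_norm_cfc (fun w => (nodePoly z).eval w) A hw
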